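/- **Sharp no-dimension Helly bound.** For sets $K_1,\dots,K_n\subset\mathbb R^d$ and $J\subset[n]=\{1,\dots,n\}$ put $K(J)=\bigcap_{j\in J}K_j$; let $B(b,\rho)$ be the closed Euclidean ball with centre $b$ and radius $\rho$, and $d(q,K)=\inf_{x\in K}|q-x|$. (i) Let $K_1,\dots,K_n$ be convex sets in $\mathbb R^d$, let $k\in[n]$ and $b\in\mathbb R^d$, and assume that $B(b,1)\cap K(J)\neq\emptyset$ for every $J\subset[n]$ with $|J|=k$. Then there is a point $q\in\mathbb R^d$ such that $$d(q,K_i)\le\sqrt{\frac{n-k}{k(n-1)}}\quad\text{for all } i\in[n]$$ (for $n=k=1$ the right-hand side is read as $0$). (ii) The bound is best possible for all $1\le k<n$, and is attained by the regular simplex. Namely, let $r=\sqrt{\frac{n-k}{k(n-1)}}$. There is a regular simplex $\triangle$ in $\mathbb R^{n-1}$ with $n$ vertices whose inscribed ball has radius $r$, and there are closed halfspaces $K_1,\dots,K_n$ such that $K_i\cap\triangle$ is the $i$-th facet of $\triangle$ (the one opposite the $i$-th vertex) for each $i$. For every such simplex, with inscribed ball $B(b,r)$, and such halfspaces, the sets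 $K_i$ are convex; $B(b,1)\cap K(J)$ is a single point for every $J\subset[n]$ with $|J|=k$; $d(b,K_i)=r$ for all $i$; and for every $q\in\mathbb R^{n-1}$ there is an $i\in[n]$ with $d(q,K_i)\ge r$. -/

import Mathlib

/-- The bound `√((n - k) / (k (n - 1)))`, all operations in `ℝ`. Only `1 ≤ k ≤ n` is of interest;
in the single case `n = k = 1` of this range where the quotient has the form `0 / 0`, it is read as
`0` (one nonempty set contains a point at distance `0` from it). -/
noncomputable def hellyRadius (n k : ℕ) : ℝ :=
  Real.sqrt (((n : ℝ) - (k : ℝ)) / ((k : ℝ) * ((n : ℝ) - 1)))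

/-- For every set `J` of exactly `k` indices, the closed unit ball about `b` meets
`K(J) = ⋂ j ∈ J, K j`. -/
def BallMeetsIntersections {d n : ℕ} (k : ℕ) (b : EuclideanSpace ℝ (Fin d))
    (K : Fin n → Set (EuclideanSpace ℝ (Fin d))) : Prop :=
  ∀ J : Finset (Fin n), J.card = k → (Metric.closedBall b 1 ∩ ⋂ j ∈ J, K j).Nonempty

/-- `H` is a closed halfspace. -/
def IsClosedHalfspace {d : ℕ} (H : Set (EuclideanSpace ℝ (Fin d))) : Prop :=
  ∃ (a : EuclideanSpace ℝ (Fin d)) (c : ℝ), a ≠ 0 ∧ H = {x | inner ℝ a x ≤ c}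

/-!
# The sharp no-dimension Helly bound

**Upper bound.** Let `ρ` be the Helly radius and suppose that no point is within `ρ` of all `K i`.
Pick a point `x J` of the unit ball about `b` in each `K(J)`, `|J| = k`, and replace `K i` by the
convex hull of the `x J` with `i ∈ J`. The `ρ`-neighbourhoods of these polytopes have no common
point, so they are separated (`exists_separating_directions`): there are vectors `u i` with `‖u i‖
≤ 1`, convex weights `α` with `∑ α i • u i = 0`, and heights `h i` in `[-1, 1]` with `h i ≤ ⟪u i,
x J - b⟫` whenever `i ∈ J`, such that `∑ α i * h i > ρ`. For nonnegative `c` supported on a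
`k`-set `J` the point `x J` gives `∑ c i * h i ≤ ‖∑ c i • u i‖`; a `k`-sparse `c` violating this
is the contradiction sought (`exists_sparse_norm_sum_lt`).

After shrinking the heights below `1`, divide each pair `(u i, h i)` by `√(1 - h i ^ 2)`. The
pairs `(p i, g i)` so obtained satisfy `‖p i‖² - g i² ≤ 1`. Write `Q c = ‖∑ c i • p i‖² - (∑ c i *
g i)²`. By the Cauchy-Schwarz inequality, the rescaled weights `α` have `1 - Q α > k (n - 1) / (n
(k - 1))` (for `k = 1` the assumptions are contradictory). If `c` minimises `Q` over the
probability weights on `t + 1` indices with `∑ c i * g i ≥ 0`, the first-order condition bounds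
the polar form of `c` and the `j`-th unit vector from below by `Q c`. Dropping the least weight of
`c` therefore multiplies `1 - Q` by at least `1 - 1 / t²`. From `n` down to `k` indices these
factors multiply to `n (k - 1) / (k (n - 1))`, leaving `k`-sparse weights with `Q < 0`
(`exists_sparse_of_lorentz`).

**Sharpness.** For a regular simplex with `m + 1` vertices, inradius `r` and incenter `g`, the
vectors `e i` from `g` to the vertices have sum zero, squared norm `m² r²` and mutual inner
products `-m r²` (`gram_of_equilateral`), and the facet halfspaces are `⟪e i, x - g⟫ ≤ -m r²`
(`eq_facetHalfspace`). Since `∑ e i = 0`, every point `q` has some `⟪e i, q - g⟫ ≥ 0` and then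
lies at distance at least `r` from that halfspace. Adding the inequalities for `i ∈ J` shows that
`K(J)` touches the unit ball in a single point (`closedBall_inter_eq_singleton`).
-/

/-! ### Two elementary facts -/

lemma exists_weight_mul_le {ι : Type*} (T : Finset ι) (hT : T.Nonempty) (c : ι → ℝ)
    (hc : ∑ i ∈ T, c i = 1) : ∃ j ∈ T, (T.card : ℝ) * c j ≤ 1 := by
  obtain ⟨j, hj, hmin⟩ := T.exists_min_image c hT
  refine ⟨j, hj, ?_⟩
  have := T.card_nsmul_le_sum c (c j) hmin
  rwa [hc, nsmul_eq_mul] at this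

lemma nonneg_of_eventually_nonneg_quadratic {a b : ℝ}
    (h : ∀ᶠ s in nhdsWithin (0 : ℝ) (Set.Ioi 0), 0 ≤ a * s + b * s ^ 2) : 0 ≤ a := by
  have hlim : Filter.Tendsto (fun s : ℝ => a + b * s) (nhdsWithin 0 (Set.Ioi 0)) (nhds a) := by
    have : Filter.Tendsto (fun s : ℝ => a + b * s) (nhds 0) (nhds (a + b * 0)) :=
      (by fun_prop : Continuous fun s : ℝ => a + b * s).tendsto 0
    rw [mul_zero, add_zero] at this
    exact this.mono_left nhdsWithin_le_nhds
  refine ge_of_tendsto hlim ?_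
  filter_upwards [h, self_mem_nhdsWithin] with s hs hs0
  have hs0 : 0 < s := hs0
  by_contra hneg
  nlinarith [mul_neg_of_pos_of_neg hs0 (not_le.1 hneg)]

/-! ### Sparse vectors in the positive Lorentz cone -/

section Lorentz

variable {E : Type*} [NormedAddCommGroup E] [InnerProductSpace ℝ E]

lemma norm_sub_smul_sq (x p : E) (s : ℝ) :
    ‖x - s • p‖ ^ 2 = ‖x‖ ^ 2 - 2 * s * inner ℝ x p + s ^ 2 * ‖p‖ ^ 2 := by
  rw [norm_sub_sq_real, norm_smul, inner_smul_right, mul_pow, Real.norm_eq_abs, sq_abs]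
  ring

/-- First-order condition for the Lorentz form `‖x‖² - y²` on the region `0 < y`: if `(x, y)`
minimises the form along the segment towards `(p, g)`, as far as the second coordinate stays
nonnegative, then the polar form of `(x, y)` and `(p, g)` is at least the minimum. -/
lemma le_lorentz_of_minimal {x p : E} {y g : ℝ} (hy : 0 < y)
    (hmin : ∀ s ∈ Set.Icc (0 : ℝ) 1, 0 ≤ (1 - s) * y + s * g →
      ‖x‖ ^ 2 - y ^ 2 ≤ ‖(1 - s) • x + s • p‖ ^ 2 - ((1 - s) * y + s * g) ^ 2) :
    ‖x‖ ^ 2 - y ^ 2 ≤ inner ℝ x p - y * g := by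
  have hpos : ∀ᶠ s in nhdsWithin (0 : ℝ) (Set.Ioi 0), 0 < (1 - s) * y + s * g := by
    have hc : Continuous fun s : ℝ => (1 - s) * y + s * g := by fun_prop
    refine nhdsWithin_le_nhds (hc.tendsto 0 (Ioi_mem_nhds ?_))
    simpa using hy
  have hone : ∀ᶠ s in nhdsWithin (0 : ℝ) (Set.Ioi 0), s < 1 :=
    nhdsWithin_le_nhds (Iio_mem_nhds one_pos)
  have key : 0 ≤ 2 * ((inner ℝ x p - y * g) - (‖x‖ ^ 2 - y ^ 2)) := by
    refine nonneg_of_eventually_nonneg_quadratic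
      (b := ‖x‖ ^ 2 - y ^ 2 - 2 * (inner ℝ x p - y * g) + (‖p‖ ^ 2 - g ^ 2)) ?_
    filter_upwards [hpos, hone, self_mem_nhdsWithin] with s h1 h2 h3
    have h := hmin s ⟨le_of_lt h3, h2.le⟩ h1.le
    rw [norm_add_sq_real, norm_smul, norm_smul, inner_smul_left, inner_smul_right, mul_pow,
      mul_pow, Real.norm_eq_abs, Real.norm_eq_abs, sq_abs, sq_abs] at h
    simp only [conj_trivial] at h
    linarith
  linarith

/-- Subtracting `c • (p, g)` from a minimiser `(x, y)` of the Lorentz form keeps it in the positive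
cone as long as the resulting upper bound for the form is negative. The sign of the second
coordinate cannot change on the way, because the form is nonnegative where that coordinate
vanishes. -/
lemma lorentz_sub_smul {x p : E} {y g c : ℝ} (hy : 0 < y) (hQ : ‖x‖ ^ 2 - y ^ 2 < 0)
    (hpg : ‖p‖ ^ 2 ≤ 1 + g ^ 2)
    (hb : ‖x‖ ^ 2 - y ^ 2 ≤ inner ℝ x p - y * g) (hc : 0 ≤ c)
    (hneg : (‖x‖ ^ 2 - y ^ 2) * (1 - 2 * c) + c ^ 2 < 0) :
    0 < y - c * g ∧
      ‖x - c • p‖ ^ 2 - (y - c * g) ^ 2 ≤ (‖x‖ ^ 2 - y ^ 2) * (1 - 2 * c) + c ^ 2 := by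
  have hexp : ∀ s, 0 ≤ s → ‖x - s • p‖ ^ 2 - (y - s * g) ^ 2 ≤
      (‖x‖ ^ 2 - y ^ 2) * (1 - 2 * s) + s ^ 2 := by
    intro s hs
    rw [norm_sub_smul_sq]
    nlinarith [mul_le_mul_of_nonneg_left hb hs, mul_le_mul_of_nonneg_left hpg (sq_nonneg s)]
  refine ⟨?_, hexp c hc⟩
  by_contra hle
  have hcg : y ≤ c * g := by linarith
  have hg : 0 < g := by
    by_contra hg
    nlinarith
  -- the linear form vanishes somewhere on the way, where the quadratic form is nonnegative
  have hsg : y / g * g = y := by field_simp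
  have hs0 : 0 < y / g := by positivity
  have hsc : y / g ≤ c := by rwa [div_le_iff₀ hg]
  have h := hexp (y / g) hs0.le
  rw [hsg, sub_self] at h
  nlinarith [sq_nonneg ‖x - (y / g) • p‖, mul_nonneg (neg_nonneg.2 hQ.le) (sub_nonneg.2 hsc)]


/-- Probability weights on `T` in which `g` has nonnegative mean form a compact set. -/
lemma isCompact_weights {ι : Type*} [Fintype ι] (T : Finset ι) (g : ι → ℝ) :
    IsCompact {c : ι → ℝ | (∀ i, 0 ≤ c i) ∧ (∀ i ∉ T, c i = 0) ∧ ∑ i, c i = 1 ∧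
      0 ≤ ∑ i, c i * g i} := by
  have h : {c : ι → ℝ | (∀ i, 0 ≤ c i) ∧ (∀ i ∉ T, c i = 0) ∧ ∑ i, c i = 1 ∧
      0 ≤ ∑ i, c i * g i} =
      stdSimplex ℝ ι ∩ ((⋂ i ∈ {i | i ∉ T}, {c | c i = 0}) ∩ {c | 0 ≤ ∑ i, c i * g i}) := by
    ext c
    simp only [stdSimplex, Set.mem_inter_iff, Set.mem_iInter, Set.mem_ofPred_eq]
    tauto
  rw [h]
  refine (isCompact_stdSimplex ℝ ι).inter_right (IsClosed.inter ?_ ?_)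
  · exact isClosed_biInter fun i _ => isClosed_eq (continuous_apply i) continuous_const
  · exact isClosed_le continuous_const (by fun_prop)

lemma descent_step_inequality {t Q Q' c : ℝ} (hc : 0 ≤ c) (hc1 : c < 1) (htc : (t + 1) * c ≤ 1)
    (ht : 2 ≤ t) (hQ : Q < 0) (h : (1 - c) ^ 2 * Q' ≤ Q * (1 - 2 * c) + c ^ 2) :
    (t ^ 2 - 1) * (1 - Q) ≤ t ^ 2 * (1 - Q') := by
  have h1 : (1 - 2 * c) * (1 - Q) ≤ (1 - c) ^ 2 * (1 - Q') := by linarith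
  have h2 : (t ^ 2 - 1) * (1 - c) ^ 2 ≤ t ^ 2 * (1 - 2 * c) := by
    nlinarith [mul_nonneg (sub_nonneg.2 htc) (by nlinarith : 0 ≤ 1 - c + t * c)]
  have h3 : 0 < (1 - c) ^ 2 := pow_pos (by linarith) 2
  have h4 := mul_le_mul_of_nonneg_right h2 (by linarith : 0 ≤ 1 - Q)
  have h5 := mul_le_mul_of_nonneg_left h1 (sq_nonneg t)
  by_contra hlt
  push Not at hlt
  have h6 := mul_lt_mul_of_pos_left hlt h3
  linarith

lemma sum_lineMap_single_smul {ι F : Type*} [Fintype ι] [DecidableEq ι] [AddCommGroup F]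
    [Module ℝ F] (c : ι → ℝ) (s : ℝ) (j : ι) (f : ι → F) :
    ∑ i, ((1 - s) * c i + s * (if i = j then 1 else 0)) • f i =
      (1 - s) • ∑ i, c i • f i + s • f j := by
  simp [add_smul, Finset.sum_add_distrib, Finset.smul_sum, mul_smul]

lemma sum_scaled_drop_smul {ι F : Type*} [Fintype ι] [DecidableEq ι] [AddCommGroup F]
    [Module ℝ F] (c : ι → ℝ) (a : ℝ) (j : ι) (f : ι → F) :
    ∑ i, (a * (if i = j then 0 else c i)) • f i = a • (∑ i, c i • f i - c j • f j) := by
  rw [← Finset.sum_erase_eq_sub (Finset.mem_univ j), Finset.smul_sum,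
    ← Finset.sum_erase (a := j) Finset.univ (by simp)]
  refine Finset.sum_congr rfl fun i hi => ?_
  rw [if_neg (Finset.ne_of_mem_erase hi), mul_smul]

/-- Descent on the size of the support. Among the weights supported on `T` with nonnegative second
coordinate take those minimising the Lorentz form `Q`. Dropping the least of the `t + 1` weights and
renormalising changes `1 - Q` by a factor of at least `(t² - 1) / t²`; the product of these factors
is `n (k - 1) / (k (n - 1))`, which is what the numerical hypothesis, preserved in each step, asks
for. -/
lemma exists_sparse_of_lorentz {ι : Type*} [Fintype ι] [DecidableEq ι] {p : ι → E} {g : ι → ℝ}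
    (hpg : ∀ i, ‖p i‖ ^ 2 ≤ 1 + g i ^ 2) {k : ℕ} (hk : 1 ≤ k) {t : ℕ} (hkt : k ≤ t) :
    ∀ T : Finset ι, T.card = t → ∀ c : ι → ℝ, (∀ i, 0 ≤ c i) → (∀ i ∉ T, c i = 0) →
      ∑ i, c i = 1 → 0 < ∑ i, c i * g i →
      (k : ℝ) * (t - 1) < t * (k - 1) * (1 - (‖∑ i, c i • p i‖ ^ 2 - (∑ i, c i * g i) ^ 2)) →
      ∃ J : Finset ι, J.card = k ∧ ∃ c' : ι → ℝ, (∀ i, 0 ≤ c' i) ∧ (∀ i ∉ J, c' i = 0) ∧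
        ‖∑ i, c' i • p i‖ < ∑ i, c' i * g i := by
  have hk' : (1 : ℝ) ≤ k := by exact_mod_cast hk
  have neg_of {t : ℕ} (hkt : k ≤ t) {Q : ℝ} (h : (k : ℝ) * (t - 1) < t * (k - 1) * (1 - Q)) :
      1 < (k : ℝ) ∧ Q < 0 := by
    have hkt' : (k : ℝ) ≤ t := by exact_mod_cast hkt
    have h1 : 1 < (k : ℝ) := by
      by_contra hle
      have : (k : ℝ) = 1 := by linarith
      rw [this] at h hkt'
      linarith
    refine ⟨h1, ?_⟩
    have h2 : 0 < (t : ℝ) * (k - 1) := mul_pos (by linarith) (by linarith)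
    by_contra hQ
    push Not at hQ
    nlinarith [mul_nonneg h2.le hQ]
  induction t, hkt using Nat.le_induction with
  | base =>
    intro T hT c hc hcT hc1 hg h
    refine ⟨T, hT, c, hc, hcT, ?_⟩
    have := (neg_of le_rfl h).2
    exact lt_of_pow_lt_pow_left₀ 2 hg.le (by linarith)
  | succ t hkt ih =>
    intro T hT c₀ hc₀ hc₀T hc₀1 hg₀ h₀
    obtain ⟨c, ⟨hc, hcT, hc1, hg⟩, hmin⟩ := (isCompact_weights T g).exists_isMinOn
      ⟨c₀, hc₀, hc₀T, hc₀1, hg₀.le⟩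
      (f := fun c : ι → ℝ => ‖∑ i, c i • p i‖ ^ 2 - (∑ i, c i * g i) ^ 2)
      (Continuous.continuousOn (by fun_prop))
    rw [isMinOn_iff] at hmin
    set x := ∑ i, c i • p i with hx
    set y := ∑ i, c i * g i with hy
    set Q := ‖x‖ ^ 2 - y ^ 2 with hQdef
    have hk1 := (neg_of (hkt.trans t.le_succ) h₀).1
    have h : (k : ℝ) * t < (t + 1) * (k - 1) * (1 - Q) := by
      have hle : Q ≤ _ := hmin c₀ ⟨hc₀, hc₀T, hc₀1, hg₀.le⟩
      refine lt_of_lt_of_le (by simpa using h₀) ?_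
      have : 0 ≤ ((t : ℝ) + 1) * (k - 1) := mul_nonneg (by positivity) (by linarith)
      exact mul_le_mul_of_nonneg_left (by linarith) this
    have hQ : Q < 0 := (neg_of (hkt.trans t.le_succ) (by push_cast; simpa using h)).2
    have hy0 : 0 < y := by
      refine lt_of_le_of_ne hg fun h0 => ?_
      rw [hQdef, ← h0] at hQ
      nlinarith [sq_nonneg ‖x‖]
    have hkt' : (k : ℝ) ≤ t := by exact_mod_cast hkt
    have ht2 : (2 : ℝ) ≤ t := by
      have : 2 ≤ t := by
        have : 1 < k := by exact_mod_cast hk1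
        omega
      exact_mod_cast this
    have hsumT : ∑ i ∈ T, c i = 1 := by
      rw [← hc1]
      exact Finset.sum_subset (Finset.subset_univ T) fun i _ hi => hcT i hi
    obtain ⟨j, hjT, hj⟩ := exists_weight_mul_le T (Finset.card_pos.1 (by omega)) c hsumT
    rw [hT] at hj
    push_cast at hj
    have hcj1 : c j < 1 := by nlinarith [hc j]
    have hb : Q ≤ inner ℝ x (p j) - y * g j := by
      refine le_lorentz_of_minimal hy0 fun s hs hsg => ?_
      have h1 := sum_lineMap_single_smul c s j p
      have h2 := sum_lineMap_single_smul c s j g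
      have h3 := sum_lineMap_single_smul c s j fun _ => (1 : ℝ)
      simp only [smul_eq_mul, mul_one] at h2 h3
      have := hmin (fun i => (1 - s) * c i + s * (if i = j then 1 else 0)) 
        ⟨fun i => ?_, fun i hi => ?_, ?_, ?_⟩
      · simpa only [h1, h2] using this
      · have := mul_nonneg (sub_nonneg.2 hs.2) (hc i)
        have := hs.1
        dsimp only
        split_ifs <;> linarith
      · have : i ≠ j := fun hij => hi (hij ▸ hjT)
        simp [hcT i hi, this]
      · rw [h3, hc1]; ring
      · rw [h2]; exact hsg
    have ht1 : ((t : ℝ) + 1) * c j ≤ 1 := hj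
    have hdrop : Q * (1 - 2 * c j) + c j ^ 2 < 0 := by
      by_contra hge
      push Not at hge
      have := descent_step_inequality (Q' := 0) (hc j) hcj1 ht1 ht2 hQ (by linarith)
      have h6 := mul_le_mul_of_nonneg_left this (by linarith : (0:ℝ) ≤ k - 1)
      have h7 := mul_lt_mul_of_pos_left h (by linarith : (0:ℝ) < t - 1)
      nlinarith
    obtain ⟨hy', hQ'⟩ := lorentz_sub_smul hy0 hQ (hpg j) hb (hc j) hdrop
    have h1c : 0 < 1 - c j := by linarith
    have h1 := sum_scaled_drop_smul c (1 - c j)⁻¹ j p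
    have h2 := sum_scaled_drop_smul c (1 - c j)⁻¹ j g
    have h3 := sum_scaled_drop_smul c (1 - c j)⁻¹ j fun _ => (1 : ℝ)
    simp only [smul_eq_mul, mul_one] at h2 h3
    refine ih (T.erase j) (by rw [Finset.card_erase_of_mem hjT, hT]; rfl)
      (fun i => (1 - c j)⁻¹ * (if i = j then 0 else c i)) (fun i => ?_) (fun i hi => ?_) ?_ ?_ ?_
    · have := hc i
      split_ifs <;> positivity
    · by_cases hij : i = j
      · simp [hij]
      · simp [hij, hcT i fun hT => hi (Finset.mem_erase.2 ⟨hij, hT⟩)]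
    · rw [h3, hc1, inv_mul_cancel₀ h1c.ne']
    · rw [h2]; positivity
    · rw [h1, h2, norm_smul, mul_pow, mul_pow, Real.norm_eq_abs, sq_abs, ← mul_sub]
      have := descent_step_inequality (Q' := (1 - c j)⁻¹ ^ 2 *
        (‖x - c j • p j‖ ^ 2 - (y - c j * g j) ^ 2)) (hc j) hcj1 ht1 ht2 hQ (by
          rw [← mul_assoc, ← mul_pow, mul_inv_cancel₀ h1c.ne', one_pow, one_mul]; exact hQ')
      have h6 := mul_le_mul_of_nonneg_left this (by linarith : (0:ℝ) ≤ k - 1)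
      have h7 := mul_lt_mul_of_pos_left h (by linarith : (0:ℝ) < t - 1)
      refine lt_of_mul_lt_mul_left (a := (t : ℝ)) ?_ (by linarith)
      linarith

lemma sq_sum_mul_le {ι : Type*} [Fintype ι] {α f : ι → ℝ} (hα : ∀ i, 0 ≤ α i)
    (hα1 : ∑ i, α i = 1) : (∑ i, α i * f i) ^ 2 ≤ ∑ i, α i * f i ^ 2 := by
  have := Finset.sum_sq_le_sum_mul_sum_of_sq_le_mul Finset.univ (r := fun i => α i * f i)
    (f := α) (g := fun i => α i * f i ^ 2) (fun i _ => hα i)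
    (fun i _ => mul_nonneg (hα i) (sq_nonneg _)) (fun i _ => by apply le_of_eq; ring)
  rwa [hα1, one_mul] at this

/-- Suppose that vectors `u i` of norm at most `1` have a vanishing convex combination in which the
heights `h i` average to more than the Helly radius. Then the halfspaces `{x | h i ≤ ⟪u i, x⟫}`, `i`
in a suitable set of `k` indices, have no common point in the unit ball; the weights `c` are a
certificate of this. -/
lemma exists_sparse_norm_sum_lt {ι : Type*} [Fintype ι] [DecidableEq ι] {u : ι → E} {h α : ι → ℝ}
    (hu : ∀ i, ‖u i‖ ≤ 1) (hh : ∀ i, |h i| < 1) (hα : ∀ i, 0 ≤ α i) (hα1 : ∑ i, α i = 1)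
    (hαu : ∑ i, α i • u i = 0) {k : ℕ} (hk : 1 ≤ k) (hkn : k < Fintype.card ι)
    (hr : hellyRadius (Fintype.card ι) k < ∑ i, α i * h i) :
    ∃ J : Finset ι, J.card = k ∧ ∃ c : ι → ℝ, (∀ i, 0 ≤ c i) ∧ (∀ i ∉ J, c i = 0) ∧
      ‖∑ i, c i • u i‖ < ∑ i, c i * h i := by
  set n : ℝ := (Fintype.card ι : ℝ) with hn
  set r := ∑ i, α i * h i with hrdef
  have hk' : (1 : ℝ) ≤ k := by exact_mod_cast hk
  have hkn' : (k : ℝ) < n := Nat.cast_lt.2 hkn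
  have hr0 : 0 < r := lt_of_le_of_lt (Real.sqrt_nonneg _) hr
  have hr2 : n - k < r ^ 2 * (k * (n - 1)) := by
    rw [← div_lt_iff₀ (mul_pos (by linarith) (by linarith))]
    exact (Real.sqrt_lt' hr0).1 hr
  have hh2 : ∀ i, 0 < 1 - h i ^ 2 := fun i => by
    have := (sq_lt_one_iff_abs_lt_one (h i)).2 (hh i)
    linarith
  set σ : ι → ℝ := fun i => √(1 - h i ^ 2) with hσ
  have hσ0 : ∀ i, 0 < σ i := fun i => Real.sqrt_pos.2 (hh2 i)
  have hσ2 : ∀ i, σ i ^ 2 = 1 - h i ^ 2 := fun i => Real.sq_sqrt (hh2 i).le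
  set A := ∑ i, α i * σ i with hA
  have hA0 : 0 < A := by
    obtain ⟨i, -, hi⟩ := Finset.exists_lt_of_sum_lt (s := Finset.univ) (f := fun _ => (0 : ℝ))
      (g := α) (by simp [hα1])
    exact Finset.sum_pos' (fun i _ => mul_nonneg (hα i) (hσ0 i).le)
      ⟨i, Finset.mem_univ i, mul_pos hi (hσ0 i)⟩
  have hA2 : A ^ 2 + r ^ 2 ≤ 1 := by
    calc A ^ 2 + r ^ 2 ≤ ∑ i, α i * σ i ^ 2 + ∑ i, α i * h i ^ 2 :=
          add_le_add (sq_sum_mul_le hα hα1) (sq_sum_mul_le hα hα1)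
      _ = 1 := by
          rw [← Finset.sum_add_distrib, ← hα1]
          refine Finset.sum_congr rfl fun i _ => ?_
          rw [hσ2]; ring
  -- rescaled by `σ i`, the pairs `(u i, h i)` have Lorentz form at most one
  have hpg : ∀ i, ‖(σ i)⁻¹ • u i‖ ^ 2 ≤ 1 + ((σ i)⁻¹ * h i) ^ 2 := fun i => by
    have h1 : ‖u i‖ ^ 2 ≤ 1 := pow_le_one₀ (norm_nonneg _) (hu i)
    have h2 : 1 = (σ i)⁻¹ ^ 2 * (1 - h i ^ 2) := by
      rw [← hσ2, ← mul_pow, inv_mul_cancel₀ (hσ0 i).ne', one_pow]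
    rw [norm_smul, mul_pow, mul_pow, Real.norm_eq_abs, sq_abs]
    nlinarith [sq_nonneg (σ i)⁻¹, mul_le_mul_of_nonneg_left h1 (sq_nonneg (σ i)⁻¹)]
  have hcσ : ∀ i, α i * σ i / A * (σ i)⁻¹ = A⁻¹ * α i := fun i => by
    have := (hσ0 i).ne'
    field_simp
  have hP : ∑ i, (α i * σ i / A) • (σ i)⁻¹ • u i = 0 := by
    simp_rw [smul_smul, hcσ, mul_smul]
    rw [← Finset.smul_sum, hαu, smul_zero]
  have hG : ∑ i, α i * σ i / A * ((σ i)⁻¹ * h i) = A⁻¹ * r := by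
    simp_rw [← mul_assoc, hcσ, mul_assoc]
    rw [← Finset.mul_sum]
  obtain ⟨J, hJ, c, hc, hcJ, hlt⟩ := exists_sparse_of_lorentz hpg hk hkn.le Finset.univ
    Finset.card_univ (fun i => α i * σ i / A)
    (fun i => div_nonneg (mul_nonneg (hα i) (hσ0 i).le) hA0.le) (by simp)
    (by rw [← Finset.sum_div, div_self hA0.ne']) (by rw [hG]; positivity) (by
      rw [hG, hP, norm_zero, ← hn]
      have hAA : 1 = A⁻¹ ^ 2 * A ^ 2 := by rw [← mul_pow, inv_mul_cancel₀ hA0.ne', one_pow]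
      have key : k * (n - 1) * A ^ 2 < n * (k - 1) * (A ^ 2 + r ^ 2) := by
        nlinarith [mul_le_mul_of_nonneg_left hA2 (by linarith : 0 ≤ n - k)]
      have := mul_lt_mul_of_pos_left key (by positivity : 0 < A⁻¹ ^ 2)
      have e1 : A⁻¹ ^ 2 * (k * (n - 1) * A ^ 2) = k * (n - 1) := by
        linear_combination (-(k * (n - 1))) * hAA
      have e2 : A⁻¹ ^ 2 * (n * (k - 1) * (A ^ 2 + r ^ 2)) =
          n * (k - 1) * (1 - (0 ^ 2 - (A⁻¹ * r) ^ 2)) := by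
        linear_combination (-(n * (k - 1))) * hAA
      linarith)
  refine ⟨J, hJ, fun i => c i * (σ i)⁻¹, fun i => mul_nonneg (hc i) (inv_nonneg.2 (hσ0 i).le),
    fun i hi => by simp [hcJ i hi], ?_⟩
  simpa only [mul_smul, mul_assoc] using hlt

/-! ### From separation to the upper bound -/

/-- Compact convex sets with empty intersection are separated by linear functionals with sum zero:
in the product space, the product of the sets is disjoint from the diagonal. -/
lemma exists_separating_directions [FiniteDimensional ℝ E] {ι : Type*} [Fintype ι]
    [DecidableEq ι] {C : ι → Set E}
    (hconv : ∀ i, Convex ℝ (C i)) (hcomp : ∀ i, IsCompact (C i)) (hempty : ⋂ i, C i = ∅) :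
    ∃ v : ι → E, ∑ i, v i = 0 ∧ ∀ a : ι → E, (∀ i, a i ∈ C i) → 0 < ∑ i, inner ℝ (v i) (a i) := by
  let D : Submodule ℝ (ι → E) :=
    LinearMap.range (LinearMap.pi fun _ : ι => (LinearMap.id : E →ₗ[ℝ] E))
  have hdisj : Disjoint (Set.univ.pi C) (D : Set (ι → E)) := by
    rw [Set.disjoint_left]
    rintro _ ha ⟨q, rfl⟩
    have : q ∈ ⋂ i, C i := Set.mem_iInter.2 fun i => ha i (Set.mem_univ i)
    rw [hempty] at this
    exact this
  obtain ⟨f, s, t, hs, hst, ht⟩ := geometric_hahn_banach_compact_closed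
    (convex_pi fun i _ => hconv i) (isCompact_univ_pi hcomp) D.convex D.closed_of_finiteDimensional
    hdisj
  have hD : ∀ a ∈ D, f a = 0 := by
    intro a ha
    by_contra hne
    have := ht (((t - 1) / f a) • a) (D.smul_mem _ ha)
    rw [map_smul, smul_eq_mul, div_mul_cancel₀ _ hne] at this
    linarith
  have ht0 : t < 0 := by simpa using ht 0 D.zero_mem
  let w : ι → E := fun i =>
    (InnerProductSpace.toDual ℝ E).symm (f.comp (ContinuousLinearMap.single ℝ (fun _ => E) i))
  have hw : ∀ a, f a = ∑ i, inner ℝ (w i) (a i) := by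
    intro a
    simp only [w, InnerProductSpace.toDual_symm_apply, ContinuousLinearMap.comp_apply,
      ContinuousLinearMap.single_apply]
    rw [← map_sum, Finset.univ_sum_single]
  refine ⟨fun i => - w i, ?_, fun a ha => ?_⟩
  · rw [Finset.sum_neg_distrib, neg_eq_zero]
    refine ext_inner_right ℝ fun q => ?_
    rw [sum_inner, inner_zero_left]
    exact (hw fun _ => q).symm.trans (hD _ ⟨q, rfl⟩)
  · have := hs a fun i _ => ha i
    rw [hw] at this
    simp only [inner_neg_left, Finset.sum_neg_distrib]
    linarith

end Lorentz

open scoped Pointwise in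
/-- The no-dimension Helly bound. The sets `K i` are replaced by the polytopes spanned by chosen
points `x J` of the unit ball about `b`, and those are thickened by the Helly radius. -/
theorem exists_infDist_le_hellyRadius {d n k : ℕ} (hk : 1 ≤ k) (hkn : k ≤ n)
    {K : Fin n → Set (EuclideanSpace ℝ (Fin d))} (hK : ∀ i, Convex ℝ (K i))
    {b : EuclideanSpace ℝ (Fin d)} (hb : BallMeetsIntersections k b K) :
    ∃ q : EuclideanSpace ℝ (Fin d), ∀ i, Metric.infDist q (K i) ≤ hellyRadius n k := by
  rcases hkn.eq_or_lt with rfl | hkn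
  · obtain ⟨q, -, hq⟩ := hb Finset.univ (by simp)
    refine ⟨q, fun i => ?_⟩
    rw [Metric.infDist_zero_of_mem (by simpa using Set.mem_iInter₂.1 hq i (Finset.mem_univ i))]
    exact Real.sqrt_nonneg _
  have hx' : ∀ J : Finset (Fin n), ∃ x : EuclideanSpace ℝ (Fin d), J.card = k →
      dist x b ≤ 1 ∧ ∀ j ∈ J, x ∈ K j := by
    intro J
    by_cases hJ : J.card = k
    · obtain ⟨x, hx1, hx2⟩ := hb J hJ
      exact ⟨x, fun _ => ⟨hx1, Set.mem_iInter₂.1 hx2⟩⟩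
    · exact ⟨b, fun h => absurd h hJ⟩
  choose x hx using hx'
  by_contra! hcon
  set ρ := hellyRadius n k with hρ
  have hρ0 : 0 ≤ ρ := Real.sqrt_nonneg _
  -- the vertices of a polytope inside `K i`
  let F : Fin n → Finset (EuclideanSpace ℝ (Fin d)) := fun i =>
    (Finset.univ.filter fun J : Finset (Fin n) => J.card = k ∧ i ∈ J).image x
  have hF : ∀ {i J}, J.card = k → i ∈ J → x J ∈ F i := fun hJ hi =>
    Finset.mem_image_of_mem _ (by simp [hJ, hi])
  have hFK : ∀ i, ∀ y ∈ F i, dist y b ≤ 1 ∧ y ∈ K i := by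
    intro i y hy
    obtain ⟨J, hJ, rfl⟩ := Finset.mem_image.1 hy
    simp only [Finset.mem_filter, Finset.mem_univ, true_and] at hJ
    exact ⟨(hx J hJ.1).1, (hx J hJ.1).2 i hJ.2⟩
  have hFne : ∀ i, (F i).Nonempty := by
    intro i
    obtain ⟨J, hiJ, -, hJ⟩ := Finset.exists_subsuperset_card_eq
      (Finset.subset_univ ({i} : Finset (Fin n))) (by simpa using hk) (by simpa using hkn.le)
    exact ⟨x J, hF hJ (hiJ (Finset.mem_singleton_self i))⟩
  obtain ⟨v, hv0, hv⟩ := exists_separating_directions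
    (C := fun i => convexHull ℝ (F i : Set (EuclideanSpace ℝ (Fin d))) + Metric.closedBall 0 ρ)
    (fun i => (convex_convexHull ℝ _).add (convex_closedBall _ _))
    (fun i => ((F i).finite_toSet.isCompact_convexHull ℝ).add (isCompact_closedBall _ _)) (by
      rw [Set.eq_empty_iff_forall_notMem]
      intro q hq
      obtain ⟨i, hi⟩ := hcon q
      obtain ⟨y, hy, z, hz, hyz⟩ := Set.mem_add.1 (Set.mem_iInter.1 hq i)
      have hyK : y ∈ K i := convexHull_min (fun y hy => (hFK i y hy).2) (hK i) hy
      refine absurd hi (not_lt.2 ((Metric.infDist_le_dist_of_mem hyK).trans ?_))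
      rw [← hyz, dist_eq_norm, add_sub_cancel_left]
      simpa using hz)
  -- the inverse of zero is zero, so `u i = 0` where `v i = 0`
  set u : Fin n → EuclideanSpace ℝ (Fin d) := fun i => ‖v i‖⁻¹ • v i with hu
  have hvu : ∀ i, v i = ‖v i‖ • u i := fun i => by
    rcases eq_or_ne (v i) 0 with h | h
    · simp [hu, h]
    · rw [hu, smul_smul, mul_inv_cancel₀ (norm_ne_zero_iff.2 h), one_smul]
  have hu1 : ∀ i, ‖u i‖ ≤ 1 := fun i => by
    rw [hu, norm_smul, norm_inv, norm_norm]
    exact inv_mul_le_one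
  choose y hyF hymin using fun i => (F i).exists_min_image (fun z => inner ℝ (u i) z) (hFne i)
  have hvinner : ∀ i z, inner ℝ (v i) z = ‖v i‖ * inner ℝ (u i) z := fun i z => by
    conv_lhs => rw [hvu i]
    rw [real_inner_smul_left]
  have huu : ∀ i, ‖v i‖ * inner ℝ (u i) (u i) = ‖v i‖ := fun i => by
    rw [← hvinner, hu, real_inner_smul_right, real_inner_self_eq_norm_sq]
    rcases eq_or_ne ‖v i‖ 0 with h | h
    · simp [h]
    · field_simp
  have hpos : ρ * ∑ i, ‖v i‖ < ∑ i, inner ℝ (v i) (y i) := by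
    have := hv (fun i => y i + (-ρ) • u i) fun i => Set.add_mem_add
      (subset_convexHull ℝ _ (hyF i)) (by
        rw [mem_closedBall_zero_iff, norm_smul, norm_neg, Real.norm_of_nonneg hρ0]
        exact mul_le_of_le_one_right hρ0 (hu1 i))
    have h2 : ∀ i, inner ℝ (v i) (y i + (-ρ) • u i) = inner ℝ (v i) (y i) - ρ * ‖v i‖ := by
      intro i
      rw [inner_add_right, real_inner_smul_right, hvinner i (u i), huu]
      ring
    simp_rw [h2] at this
    rw [Finset.sum_sub_distrib, ← Finset.mul_sum] at this
    linarith
  set A := ∑ i, ‖v i‖ with hA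
  have hA0 : 0 < A := by
    refine lt_of_le_of_ne (Finset.sum_nonneg fun i _ => norm_nonneg _) fun h => ?_
    have hz : ∀ i, v i = 0 := fun i => norm_eq_zero.1
      ((Finset.sum_eq_zero_iff_of_nonneg fun i _ => norm_nonneg _).1 h.symm i (Finset.mem_univ i))
    simp [hz, ← h] at hpos
  set h : Fin n → ℝ := fun i => inner ℝ (u i) (y i - b) with hh
  have hh1 : ∀ i, |h i| ≤ 1 := fun i => by
    refine (abs_real_inner_le_norm _ _).trans (mul_le_one₀ (hu1 i) (norm_nonneg _) ?_)
    rw [← dist_eq_norm]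
    exact (hFK i _ (hyF i)).1
  have hαh : ρ < ∑ i, ‖v i‖ / A * h i := by
    have h1 : ∑ i, ‖v i‖ / A * h i = (∑ i, inner ℝ (v i) (y i)) / A := by
      have h2 : ∀ i, ‖v i‖ / A * h i = (inner ℝ (v i) (y i) - inner ℝ (v i) b) / A := fun i => by
        rw [← inner_sub_right, hvinner i]
        ring
      simp_rw [h2]
      rw [← Finset.sum_div, Finset.sum_sub_distrib, ← sum_inner _ _ b, hv0, inner_zero_left,
        sub_zero]
    rwa [h1, lt_div_iff₀ hA0]
  -- shrinking the heights slightly makes them less than one in absolute value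
  obtain ⟨τ, hτ1, hτ2⟩ := exists_between ((div_lt_one (hρ0.trans_lt hαh)).2 hαh)
  have hτ0 : 0 ≤ τ := (div_nonneg hρ0 (hρ0.trans hαh.le)).trans hτ1.le
  obtain ⟨J, hJ, c, hc, hcJ, hlt⟩ := exists_sparse_norm_sum_lt (u := u) (h := fun i => τ * h i)
    (α := fun i => ‖v i‖ / A) hu1
    (fun i => by
      rw [abs_mul, abs_of_nonneg hτ0]
      nlinarith [hh1 i, abs_nonneg (h i)])
    (fun i => by positivity) (by rw [← Finset.sum_div, div_self hA0.ne'])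
    (by
      have : ∀ i, (‖v i‖ / A) • u i = A⁻¹ • v i := fun i => by
        rw [div_eq_inv_mul, mul_smul, ← hvu]
      simp_rw [this]
      rw [← Finset.smul_sum, hv0, smul_zero])
    hk (by simpa using hkn) (by
      rw [Fintype.card_fin]
      have : ∑ i, ‖v i‖ / A * (τ * h i) = τ * ∑ i, ‖v i‖ / A * h i := by
        rw [Finset.mul_sum]
        exact Finset.sum_congr rfl fun i _ => by ring
      rw [this]
      rwa [div_lt_iff₀ (hρ0.trans_lt hαh)] at hτ1)
  -- the point `x J` refutes the certificate
  have hle : ∑ i, c i * h i ≤ ‖∑ i, c i • u i‖ := by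
    calc ∑ i, c i * h i ≤ ∑ i, c i * inner ℝ (u i) (x J - b) := by
          refine Finset.sum_le_sum fun i _ => ?_
          by_cases hi : i ∈ J
          · refine mul_le_mul_of_nonneg_left ?_ (hc i)
            rw [hh]
            simp only [inner_sub_right]
            linarith [hymin i (x J) (hF hJ hi)]
          · simp [hcJ i hi]
      _ = inner ℝ (∑ i, c i • u i) (x J - b) := by
          rw [sum_inner]
          simp_rw [real_inner_smul_left]
      _ ≤ ‖∑ i, c i • u i‖ := by
          refine (real_inner_le_norm _ _).trans (mul_le_of_le_one_right (norm_nonneg _) ?_)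
          rw [← dist_eq_norm]
          exact (hx J hJ).1
  have hsum : ∑ i, c i * (τ * h i) = τ * ∑ i, c i * h i := by
    rw [Finset.mul_sum]
    exact Finset.sum_congr rfl fun i _ => by ring
  rw [hsum] at hlt
  have := norm_nonneg (∑ i, c i • u i)
  nlinarith [mul_le_mul_of_nonneg_left hle hτ0]

/-! ### Gram matrices of equidistant vectors -/

section Gram

variable {E : Type*} [NormedAddCommGroup E] [InnerProductSpace ℝ E] {m : ℕ}

/-- The Gram matrix of `m + 1` vectors with sum zero and all mutual squared distances `L`, stated
without division. -/
lemma gram_of_equidistant {e : Fin (m + 1) → E} {L : ℝ} (hsum : ∑ i, e i = 0)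
    (hL : ∀ i j, i ≠ j → ‖e i - e j‖ ^ 2 = L) :
    (∀ i, 2 * (m + 1) * ‖e i‖ ^ 2 = m * L) ∧
      ∀ i j, i ≠ j → 2 * (m + 1) * inner ℝ (e i) (e j) = -L := by
  have hrow : ∀ i, m * L = (m + 1) * ‖e i‖ ^ 2 + ∑ j, ‖e j‖ ^ 2 := by
    intro i
    have h1 : ∑ j, ‖e i - e j‖ ^ 2 = m * L := by
      rw [← Finset.sum_erase (a := i) Finset.univ (by simp),
        Finset.sum_congr rfl fun j hj => hL i j (Finset.ne_of_mem_erase hj).symm]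
      simp
    rw [← h1]
    simp_rw [norm_sub_sq_real]
    rw [Finset.sum_add_distrib, Finset.sum_sub_distrib, ← Finset.mul_sum, ← inner_sum, hsum]
    simp
  have htot : (2 : ℝ) * ∑ j, ‖e j‖ ^ 2 = m * L := by
    have h2 := Finset.sum_congr rfl fun i (_ : i ∈ Finset.univ) => hrow i
    rw [Finset.sum_add_distrib, ← Finset.mul_sum Finset.univ (fun i => ‖e i‖ ^ 2)] at h2
    simp only [Finset.sum_const, Finset.card_univ, Fintype.card_fin, nsmul_eq_mul, Nat.cast_add,
      Nat.cast_one] at h2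
    have hm : (0 : ℝ) < m + 1 := by positivity
    refine mul_left_cancel₀ hm.ne' ?_
    linarith
  have hnorm : ∀ i, 2 * (m + 1) * ‖e i‖ ^ 2 = m * L := fun i => by linarith [hrow i]
  refine ⟨hnorm, fun i j hij => ?_⟩
  have h := hL i j hij
  rw [norm_sub_sq_real] at h
  linear_combination (-(m + 1 : ℝ)) * h + (1 / 2 : ℝ) * hnorm i + (1 / 2 : ℝ) * hnorm j

variable {e : Fin (m + 1) → E} {r : ℝ}

lemma inner_sum_of_gram
    (hin : ∀ i j, inner ℝ (e i) (e j) = if i = j then m ^ 2 * r ^ 2 else -m * r ^ 2)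
    (J : Finset (Fin (m + 1))) (j : Fin (m + 1)) (hj : j ∈ J) :
    inner ℝ (e j) (∑ i ∈ J, e i) = m * r ^ 2 * (m + 1 - J.card) := by
  rw [inner_sum]
  have : ∀ i, inner ℝ (e j) (e i) = (if j = i then m * (m + 1) * r ^ 2 else 0) - m * r ^ 2 := by
    intro i
    rw [hin]
    split_ifs <;> ring
  simp_rw [this]
  rw [Finset.sum_sub_distrib, Finset.sum_ite_eq, if_pos hj, Finset.sum_const, nsmul_eq_mul]
  ring

end Gram

/-! ### Construction of a regular simplex -/

section Existence

variable (m : ℕ)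

/-- The linear form on `ℝ^(m+1)` summing the coordinates. -/
noncomputable def sumCoords : EuclideanSpace ℝ (Fin (m + 1)) →ₗ[ℝ] ℝ :=
  ∑ i, (EuclideanSpace.proj i : EuclideanSpace ℝ (Fin (m + 1)) →L[ℝ] ℝ).toLinearMap

/-- The points of `ℝ^(m+1)` whose coordinates sum to zero. -/
noncomputable def sumZero : Submodule ℝ (EuclideanSpace ℝ (Fin (m + 1))) :=
  LinearMap.ker (sumCoords m)

variable {m}

lemma mem_sumZero {x : EuclideanSpace ℝ (Fin (m + 1))} : x ∈ sumZero m ↔ ∑ i, x i = 0 := by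
  simp [sumZero, sumCoords]

lemma finrank_sumZero : Module.finrank ℝ (sumZero m) = m := by
  have hsurj : Function.Surjective (sumCoords m) := fun a =>
    ⟨EuclideanSpace.single 0 a, by simp [sumCoords]⟩
  have := LinearMap.finrank_range_add_finrank_ker (sumCoords m)
  rw [LinearMap.range_eq_top.2 hsurj, finrank_top, finrank_euclideanSpace, Fintype.card_fin,
    Module.finrank_self] at this
  rw [sumZero]
  omega

/-- The linear isometry of the hyperplane `sumZero m` that permutes the coordinates by `σ`. -/
noncomputable def permSumZero (σ : Equiv.Perm (Fin (m + 1))) : sumZero m ≃ₗᵢ[ℝ] sumZero m :=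
  LinearIsometry.toLinearIsometryEquiv
    { toLinearMap := (LinearIsometryEquiv.piLpCongrLeft 2 ℝ ℝ σ).toLinearEquiv.toLinearMap.restrict
        (p := sumZero m) (q := sumZero m) (fun x hx => by
          rw [mem_sumZero] at hx ⊢
          simpa using (Equiv.sum_comp σ.symm fun i => x i).trans hx)
      norm_map' := fun x => by
        rw [Submodule.coe_norm, LinearMap.coe_restrict_apply]
        exact (LinearIsometryEquiv.piLpCongrLeft 2 ℝ ℝ σ).norm_map x } rfl

lemma coe_permSumZero (σ : Equiv.Perm (Fin (m + 1))) (x : sumZero m) :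
    (permSumZero σ x : EuclideanSpace ℝ (Fin (m + 1))) =
      LinearIsometryEquiv.piLpCongrLeft 2 ℝ ℝ σ x := rfl

/-- The `i`-th standard basis vector of `ℝ^(m+1)` minus the mean of all of them, as a point of the
hyperplane `sumZero m`. -/
noncomputable def centeredSingle (i : Fin (m + 1)) : sumZero m :=
  ⟨EuclideanSpace.single i 1 - WithLp.toLp 2 fun _ => ((m : ℝ) + 1)⁻¹, by
    rw [mem_sumZero]
    have : (m : ℝ) + 1 ≠ 0 := by positivity
    simp [Finset.sum_sub_distrib, this]⟩

lemma permSumZero_centeredSingle (σ : Equiv.Perm (Fin (m + 1))) (i : Fin (m + 1)) :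
    permSumZero σ (centeredSingle i) = centeredSingle (σ i) := by
  apply Subtype.ext
  rw [coe_permSumZero, centeredSingle, centeredSingle, map_sub]
  congr 1
  · exact EuclideanSpace.piLpCongrLeft_single σ i 1

/-- Regularity needs isometries of all of `ℝ^m`; they come from the permutations of coordinates of
the hyperplane `sumZero m`, which is identified with `ℝ^m`. -/
lemma exists_regular_simplex {t : ℝ} (ht : 0 < t) :
    ∃ S : Affine.Simplex ℝ (EuclideanSpace ℝ (Fin m)) m, S.Regular ∧
      ∀ i j, i ≠ j → dist (S.points i) (S.points j) ^ 2 = 2 * t ^ 2 := by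
  let φ : sumZero m ≃ₗᵢ[ℝ] EuclideanSpace ℝ (Fin m) :=
    ((stdOrthonormalBasis ℝ (sumZero m)).reindex (finCongr finrank_sumZero)).repr
  let p : Fin (m + 1) → EuclideanSpace ℝ (Fin m) := fun i => t • φ (centeredSingle i)
  let f : EuclideanSpace ℝ (Fin m) →ᵃ[ℝ] EuclideanSpace ℝ (Fin (m + 1)) :=
    (t⁻¹ • (sumZero m).subtype ∘ₗ φ.symm.toLinearEquiv.toLinearMap).toAffineMap +
      AffineMap.const ℝ _ (WithLp.toLp 2 fun _ => ((m : ℝ) + 1)⁻¹)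
  have hfp : ∀ i, f (p i) = EuclideanSpace.single i (1 : ℝ) := fun i => by
    have : φ.symm (p i) = t • centeredSingle i := by simp [p]
    simp [f, this, smul_smul, ht.ne', centeredSingle]
  have hind : AffineIndependent ℝ p := by
    refine AffineIndependent.of_comp f ?_
    have h := (EuclideanSpace.basisFun (Fin (m + 1)) ℝ).orthonormal.linearIndependent
      |>.affineIndependent
    have hfp' : f ∘ p = EuclideanSpace.basisFun (Fin (m + 1)) ℝ := by
      ext1 i
      simp [hfp]
    rw [hfp']
    exact h
  refine ⟨⟨p, hind⟩, fun σ => ?_, fun i j hij => ?_⟩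
  · refine ⟨((φ.symm.trans (permSumZero σ)).trans φ).toIsometryEquiv, ?_⟩
    ext1 i
    simp [p, permSumZero_centeredSingle]
  · have h1 : dist (p i) (p j) = t * ‖(centeredSingle i - centeredSingle j : sumZero m)‖ := by
      rw [dist_eq_norm]
      simp only [p]
      rw [← smul_sub, ← map_sub, norm_smul, φ.norm_map, Real.norm_of_nonneg ht.le]
    change dist (p i) (p j) ^ 2 = _
    have h2 : ((centeredSingle i - centeredSingle j : sumZero m) : EuclideanSpace ℝ (Fin (m + 1))) =
        EuclideanSpace.single i 1 - EuclideanSpace.single j 1 := by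
      simp [centeredSingle]
    rw [h1, Submodule.coe_norm, h2, mul_pow, norm_sub_sq_real]
    simp [EuclideanSpace.inner_single_left, hij]
    ring

end Existence

/-! ### Incenter and facet halfspaces of an equilateral simplex -/

section Simplex

lemma eq_zero_of_inner_edges_eq_zero {m : ℕ}
    {S : Affine.Simplex ℝ (EuclideanSpace ℝ (Fin m)) m} (i : Fin (m + 1))
    {x : EuclideanSpace ℝ (Fin m)} (hx : ∀ j, inner ℝ (S.points i - S.points j) x = 0) : x = 0 := by
  have htop : vectorSpan ℝ (Set.range S.points) = ⊤ :=
    S.independent.vectorSpan_eq_top_of_card_eq_finrank_add_one (by simp)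
  rw [vectorSpan_range_eq_span_range_vsub_left ℝ S.points i] at htop
  have : x ∈ (⊤ : Submodule ℝ (EuclideanSpace ℝ (Fin m)))ᗮ := by
    rw [← htop, Submodule.mem_orthogonal]
    intro u hu
    induction hu using Submodule.span_induction with
    | mem u hu => obtain ⟨j, rfl⟩ := hu; exact hx j
    | zero => simp
    | add a b _ _ ha hb => rw [inner_add_left, ha, hb, add_zero]
    | smul c a _ ha => rw [inner_smul_left, ha, mul_zero]
  simpa using this

variable {m : ℕ} [NeZero m] {S : Affine.Simplex ℝ (EuclideanSpace ℝ (Fin m)) m}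

/-- In an equilateral simplex of full dimension the heights are equal, so the incenter is the
centroid; the Gram matrix of the vertices about it is expressed through the inradius. -/
lemma gram_of_equilateral {L : ℝ}
    (hL : ∀ i j, i ≠ j → dist (S.points i) (S.points j) ^ 2 = L) :
    ∑ i, (S.points i - S.incenter) = 0 ∧ L = 2 * m * (m + 1) * S.inradius ^ 2 ∧
      ∀ i j, inner ℝ (S.points i - S.incenter) (S.points j - S.incenter) =
        if i = j then m ^ 2 * S.inradius ^ 2 else -m * S.inradius ^ 2 := by
  have hm : (0 : ℝ) < m := by exact_mod_cast Nat.pos_of_neZero m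
  set c : EuclideanSpace ℝ (Fin m) := ((m : ℝ) + 1)⁻¹ • ∑ i, S.points i with hc
  have hsum : ∑ i, (S.points i - c) = 0 := by
    have : (m : ℝ) + 1 ≠ 0 := by positivity
    rw [Finset.sum_sub_distrib, Finset.sum_const, hc, Finset.card_univ, Fintype.card_fin,
      ← Nat.cast_smul_eq_nsmul ℝ, smul_smul]
    simp [this]
  obtain ⟨hn, hi⟩ := gram_of_equidistant (e := fun i => S.points i - c) (L := L) hsum
    (fun i j hij => by rw [sub_sub_sub_cancel_right, ← dist_eq_norm]; exact hL i j hij)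
  have hother : ∀ i : Fin (m + 1), ∃ j, i ≠ j := fun i => by
    have : Nontrivial (Fin (m + 1)) := Fin.nontrivial_iff_two_le.2 (by
      have := Nat.pos_of_neZero m; omega)
    exact (exists_ne i).imp fun j hj => hj.symm
  have hL0 : 0 < L := by
    obtain ⟨j, hj⟩ := hother 0
    rw [← hL 0 j hj]
    exact pow_pos (dist_pos.2 (S.independent.injective.ne hj)) 2
  have hheight : ∀ i, S.height i ^ 2 = (m + 1) * L / (2 * m) := by
    intro i
    set v := S.points i - S.altitudeFoot i with hv
    have hvn : ‖v‖ ^ 2 = S.height i ^ 2 := by rw [Affine.Simplex.height, dist_eq_norm]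
    -- the altitude and the vector from the centroid have proportional products with the edges
    have hve : v = (2 * S.height i ^ 2 / L) • (S.points i - c) := by
      rw [← sub_eq_zero]
      refine eq_zero_of_inner_edges_eq_zero (S := S) i fun j => ?_
      rcases eq_or_ne i j with rfl | hij
      · simp
      have h1 : inner ℝ (S.points i - S.points j) v = S.height i ^ 2 :=
        S.inner_vsub_vsub_altitudeFoot_eq_height_sq hij
      have h2 : inner ℝ (S.points i - S.points j) (S.points i - c) = L / 2 := by
        rw [← sub_sub_sub_cancel_right _ _ c, inner_sub_left, real_inner_self_eq_norm_sq]
        have h3 := hn i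
        have h4 := hi j i hij.symm
        have : (m : ℝ) + 1 ≠ 0 := by positivity
        refine mul_left_cancel₀ (mul_ne_zero two_ne_zero this) ?_
        linear_combination h3 - h4
      rw [inner_sub_right, inner_smul_right, h1, h2]
      field_simp
      ring
    have hh := S.height_pos i
    rw [hve, norm_smul, mul_pow, Real.norm_eq_abs, sq_abs] at hvn
    have h3 := hn i
    have hne : ‖S.points i - c‖ ^ 2 = m * L / (2 * (m + 1)) := by
      field_simp
      linarith
    rw [hne] at hvn
    field_simp at hvn ⊢
    linarith
  have hH : ∀ i, S.height i = √((m + 1) * L / (2 * m)) := fun i => by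
    rw [← hheight i, Real.sqrt_sq (S.height_pos i).le]
  set H := √((m + 1) * L / (2 * m)) with hHdef
  have hH0 : 0 < H := by rw [← hH 0]; exact S.height_pos 0
  have hunn : ∑ i, S.excenterWeightsUnnorm ∅ i = (m + 1) * H⁻¹ := by
    simp [Affine.Simplex.excenterWeightsUnnorm, hH]
  have hr : S.inradius = H / (m + 1) := by
    rw [S.inradius_eq_abs_inv_sum, hunn, abs_of_pos (by positivity)]
    field_simp
  have hinc : S.incenter = c := by
    rw [S.incenter_eq_affineCombination, Finset.affineCombination_eq_linear_combination _ _ _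
      (S.sum_excenterWeights_eq_one_iff.2 S.excenterExists_empty), hc, Finset.smul_sum]
    refine Finset.sum_congr rfl fun i _ => ?_
    congr 1
    rw [Affine.Simplex.excenterWeights, hunn]
    simp only [Pi.smul_apply, Affine.Simplex.excenterWeightsUnnorm_empty_apply, hH, smul_eq_mul]
    field_simp
  have hLr : L = 2 * m * (m + 1) * S.inradius ^ 2 := by
    have : H ^ 2 = (m + 1) * L / (2 * m) := by rw [← hH 0, hheight]
    rw [hr, div_pow, this]
    field_simp
  refine ⟨by rw [hinc]; exact hsum, hLr, fun i j => ?_⟩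
  rw [hinc]
  have hne : (2 * ((m : ℝ) + 1)) ≠ 0 := by positivity
  refine mul_left_cancel₀ hne ?_
  split_ifs with hij
  · subst hij
    rw [real_inner_self_eq_norm_sq, hn i, hLr]
    ring
  · rw [hi i j hij, hLr]
    ring

/-- The linear form given by the direction from the incenter to the `i`-th vertex is an affine
function of the `i`-th barycentric coordinate. -/
lemma inner_affineCombination_sub_incenter {L : ℝ}
    (hL : ∀ i j, i ≠ j → dist (S.points i) (S.points j) ^ 2 = L) {w : Fin (m + 1) → ℝ}
    (hw : ∑ i, w i = 1) (i : Fin (m + 1)) :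
    inner ℝ (S.points i - S.incenter) (Finset.univ.affineCombination ℝ S.points w - S.incenter) =
      -m * S.inradius ^ 2 + w i * (m * (m + 1) * S.inradius ^ 2) := by
  obtain ⟨-, -, hin⟩ := gram_of_equilateral hL
  have h1 : Finset.univ.affineCombination ℝ S.points w - S.incenter =
      ∑ j, w j • (S.points j - S.incenter) := by
    rw [Finset.affineCombination_eq_linear_combination _ _ _ hw]
    simp_rw [smul_sub]
    rw [Finset.sum_sub_distrib, ← Finset.sum_smul, hw, one_smul]
  rw [h1, inner_sum]
  have h2 : ∀ j, inner ℝ (S.points i - S.incenter) (w j • (S.points j - S.incenter)) =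
      (if i = j then w j * (m * (m + 1) * S.inradius ^ 2) else 0) - w j * (m * S.inradius ^ 2) := by
    intro j
    rw [inner_smul_right, hin]
    split_ifs <;> ring
  simp_rw [h2]
  rw [Finset.sum_sub_distrib, Finset.sum_ite_eq, if_pos (Finset.mem_univ i), ← Finset.sum_mul, hw]
  ring

lemma facetHalfspace_inter_closedInterior {L : ℝ}
    (hL : ∀ i j, i ≠ j → dist (S.points i) (S.points j) ^ 2 = L) (i : Fin (m + 1)) :
    {x | inner ℝ (S.points i - S.incenter) (x - S.incenter) ≤ -m * S.inradius ^ 2} ∩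
      S.closedInterior = (S.faceOpposite i).closedInterior := by
  have hm : (0 : ℝ) < m := by exact_mod_cast Nat.pos_of_neZero m
  have hr := S.inradius_pos
  have hpos : 0 < m * (m + 1) * S.inradius ^ 2 := by positivity
  have key : ∀ w : Fin (m + 1) → ℝ, ∑ i, w i = 1 →
      (Finset.univ.affineCombination ℝ S.points w ∈
        {x | inner ℝ (S.points i - S.incenter) (x - S.incenter) ≤ -m * S.inradius ^ 2} ∩
          S.closedInterior ↔
        Finset.univ.affineCombination ℝ S.points w ∈ (S.faceOpposite i).closedInterior) := by
    intro w hw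
    rw [Affine.Simplex.faceOpposite,
      Affine.Simplex.affineCombination_mem_closedInterior_face_iff_mem_Icc _ _ hw,
      Set.mem_inter_iff, Affine.Simplex.affineCombination_mem_closedInterior_iff hw,
      Set.mem_ofPred_eq, inner_affineCombination_sub_incenter hL hw]
    simp only [Finset.mem_compl, Finset.mem_singleton, not_not, forall_eq]
    constructor
    · rintro ⟨h1, h2⟩
      refine ⟨fun j _ => h2 j, le_antisymm ?_ (h2 i).1⟩
      by_contra hlt
      have := mul_pos (not_le.1 hlt) hpos
      linarith
    · rintro ⟨h1, h2⟩
      refine ⟨by rw [h2]; linarith, fun j => ?_⟩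
      rcases eq_or_ne j i with rfl | hij
      · simp [h2]
      · exact h1 j hij
  ext x
  constructor
  · rintro hx
    obtain ⟨w, hw, -, rfl⟩ := hx.2
    exact (key w hw).1 hx
  · intro hx
    obtain ⟨w, hw, -, rfl⟩ := S.closedInterior_faceOpposite_subset_closedInterior i hx
    exact (key w hw).2 hx

/-- A closed halfspace that meets the simplex exactly in the `i`-th facet is bounded by the
hyperplane of that facet and does not contain the `i`-th vertex, hence is unique. -/
lemma eq_facetHalfspace {L : ℝ}
    (hL : ∀ i j, i ≠ j → dist (S.points i) (S.points j) ^ 2 = L) {i : Fin (m + 1)}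
    {K : Set (EuclideanSpace ℝ (Fin m))} (hK : IsClosedHalfspace K)
    (hKi : K ∩ S.closedInterior = (S.faceOpposite i).closedInterior) :
    K = {x | inner ℝ (S.points i - S.incenter) (x - S.incenter) ≤ -m * S.inradius ^ 2} := by
  have hm : (0 : ℝ) < m := by exact_mod_cast Nat.pos_of_neZero m
  have hr := S.inradius_pos
  obtain ⟨-, -, hin⟩ := gram_of_equilateral hL
  obtain ⟨a, c, -, rfl⟩ := hK
  have hmem : ∀ x ∈ S.closedInterior,
      (inner ℝ a x ≤ c ↔ x ∈ (S.faceOpposite i).closedInterior) := by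
    intro x hx
    rw [← hKi]
    exact ⟨fun h => ⟨h, hx⟩, fun h => h.1⟩
  have hi : c < inner ℝ a (S.points i) := by
    by_contra hle
    have := (hmem _ (S.point_mem_closedInterior i)).1 (not_lt.1 hle)
    simp at this
  have hj : ∀ j, j ≠ i → inner ℝ a (S.points j) = c := by
    intro j hji
    refine le_antisymm ((hmem _ (S.point_mem_closedInterior j)).2 (by simpa using hji)) ?_
    by_contra hlt
    push Not at hlt
    -- a point of the edge near the `j`-th vertex lies in the halfspace but not in the facet
    set A := inner ℝ a (S.points i)
    set B := inner ℝ a (S.points j)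
    set s := (c - B) / (A - B) with hs
    have hAB : 0 < A - B := by linarith
    have hs0 : 0 < s := div_pos (by linarith) hAB
    have hs1 : s ≤ 1 := by rw [hs, div_le_one hAB]; linarith
    have hsc : s * (A - B) = c - B := div_mul_cancel₀ _ hAB.ne'
    set w : Fin (m + 1) → ℝ := fun l => (if l = i then s else 0) + (if l = j then 1 - s else 0)
    have hw : ∑ l, w l = 1 := by simp [w, Finset.sum_add_distrib]
    have hx : Finset.univ.affineCombination ℝ S.points w =
        s • S.points i + (1 - s) • S.points j := by
      rw [Finset.affineCombination_eq_linear_combination _ _ _ hw]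
      simp [w, add_smul, Finset.sum_add_distrib]
    have h1 : Finset.univ.affineCombination ℝ S.points w ∈ S.closedInterior := by
      rw [Affine.Simplex.affineCombination_mem_closedInterior_iff hw]
      intro l
      have hij := hji.symm
      simp only [w]
      constructor
      · split_ifs <;> linarith
      · split_ifs with h2 h3
        · exact absurd (h3.symm.trans h2) hji
        all_goals linarith
    have h2 := (hmem _ h1).1 (by
      rw [hx, inner_add_right, inner_smul_right, inner_smul_right]
      linarith)
    rw [Affine.Simplex.faceOpposite,
      Affine.Simplex.affineCombination_mem_closedInterior_face_iff_mem_Icc _ _ hw] at h2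
    have h3 := h2.2 i (by simp)
    simp [w, hji.symm] at h3
    linarith
  set A := inner ℝ a (S.points i) with hA
  have hpos : 0 < m * (m + 1) * S.inradius ^ 2 := by positivity
  set t := (A - c) / (m * (m + 1) * S.inradius ^ 2) with ht
  have ht0 : 0 < t := div_pos (by linarith) hpos
  have hae : a = t • (S.points i - S.incenter) := by
    rw [← sub_eq_zero]
    refine eq_zero_of_inner_edges_eq_zero (S := S) i fun j => ?_
    rcases eq_or_ne j i with rfl | hji
    · simp
    have h1 : inner ℝ (S.points i - S.points j) a = A - c := by
      rw [real_inner_comm, inner_sub_right, hj j hji]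
    have h2 : inner ℝ (S.points i - S.points j) (S.points i - S.incenter) =
        m * (m + 1) * S.inradius ^ 2 := by
      rw [← sub_sub_sub_cancel_right _ _ S.incenter, inner_sub_left, hin, hin, if_pos rfl,
        if_neg hji]
      ring
    rw [inner_sub_right, inner_smul_right, h1, h2, ht, div_mul_cancel₀ _ hpos.ne', sub_self]
  have hc : c = inner ℝ a S.incenter + t * (-m * S.inradius ^ 2) := by
    have h1 : A = inner ℝ a S.incenter + t * (m ^ 2 * S.inradius ^ 2) := by
      rw [← sub_eq_iff_eq_add', hA, ← inner_sub_right]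
      conv_lhs => rw [hae]
      rw [real_inner_smul_left, hin, if_pos rfl]
    have h2 : t * (m * (m + 1) * S.inradius ^ 2) = A - c := div_mul_cancel₀ _ hpos.ne'
    linear_combination h1 + h2
  ext x
  have hx : inner ℝ a x = inner ℝ a S.incenter +
      t * inner ℝ (S.points i - S.incenter) (x - S.incenter) := by
    rw [← sub_eq_iff_eq_add', ← inner_sub_right]
    conv_lhs => rw [hae]
    rw [real_inner_smul_left]
  rw [Set.mem_ofPred_eq, Set.mem_ofPred_eq, hx, hc, add_le_add_iff_left,
    mul_le_mul_iff_right₀ ht0]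

end Simplex

/-! ### Extremality of the facet halfspaces -/

section Extremal

variable {E : Type*} [NormedAddCommGroup E] [InnerProductSpace ℝ E] {m : ℕ} {r : ℝ}
  {e : Fin (m + 1) → E} {g : E}

lemma exists_inner_nonneg_of_sum_eq_zero (hsum : ∑ i, e i = 0) (x : E) :
    ∃ i, 0 ≤ inner ℝ (e i) x := by
  by_contra! h
  have := Finset.sum_neg (fun i _ => h i) (Finset.univ_nonempty (α := Fin (m + 1)))
  rw [← sum_inner, hsum, inner_zero_left] at this
  exact lt_irrefl _ this

lemma norm_of_gram (hr : 0 ≤ r) (hin : ∀ i j, inner ℝ (e i) (e j) =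
    if i = j then m ^ 2 * r ^ 2 else -m * r ^ 2) (i : Fin (m + 1)) : ‖e i‖ = m * r := by
  have := hin i i
  rw [if_pos rfl, real_inner_self_eq_norm_sq, ← mul_pow] at this
  exact (pow_left_inj₀ (norm_nonneg _) (by positivity) two_ne_zero).1 this

/-- `g - m⁻¹ • e i` is the point where the inscribed ball about `g` touches the `i`-th facet. -/
lemma facetPoint_mem (hm : 0 < m) (hin : ∀ i j, inner ℝ (e i) (e j) =
    if i = j then m ^ 2 * r ^ 2 else -m * r ^ 2) (i : Fin (m + 1)) :
    g - (m : ℝ)⁻¹ • e i ∈ {x | inner ℝ (e i) (x - g) ≤ -m * r ^ 2} := by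
  have hm' : (m : ℝ) ≠ 0 := by positivity
  rw [Set.mem_ofPred_eq, sub_sub_cancel_left, inner_neg_right, inner_smul_right, hin, if_pos rfl]
  apply le_of_eq
  field_simp

lemma le_infDist_of_inner_nonneg (hm : 0 < m) (hr : 0 ≤ r) (hin : ∀ i j, inner ℝ (e i) (e j) =
    if i = j then m ^ 2 * r ^ 2 else -m * r ^ 2) {i : Fin (m + 1)} {q : E}
    (hq : 0 ≤ inner ℝ (e i) (q - g)) :
    r ≤ Metric.infDist q {x | inner ℝ (e i) (x - g) ≤ -m * r ^ 2} := by
  rw [Metric.le_infDist ⟨_, facetPoint_mem hm hin i⟩]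
  intro x hx
  rw [Set.mem_ofPred_eq] at hx
  rcases hr.eq_or_lt with rfl | hr
  · exact dist_nonneg
  have hm' : (0 : ℝ) < m := by exact_mod_cast hm
  have h1 : m * r * r ≤ m * r * dist q x := by
    calc m * r * r ≤ inner ℝ (e i) (q - x) := by
          rw [← sub_sub_sub_cancel_right q x g, inner_sub_right]
          linarith
      _ ≤ ‖e i‖ * ‖q - x‖ := real_inner_le_norm _ _
      _ = m * r * dist q x := by rw [norm_of_gram hr.le hin, dist_eq_norm]
  exact le_of_mul_le_mul_left h1 (by positivity)

lemma infDist_center (hm : 0 < m) (hr : 0 ≤ r) (hin : ∀ i j, inner ℝ (e i) (e j) =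
    if i = j then m ^ 2 * r ^ 2 else -m * r ^ 2) (i : Fin (m + 1)) :
    Metric.infDist g {x | inner ℝ (e i) (x - g) ≤ -m * r ^ 2} = r := by
  have hm' : (0 : ℝ) < m := by exact_mod_cast hm
  refine le_antisymm ((Metric.infDist_le_dist_of_mem (facetPoint_mem hm hin i)).trans ?_)
    (le_infDist_of_inner_nonneg hm hr hin (by simp))
  rw [dist_eq_norm, sub_sub_cancel, norm_smul, norm_of_gram hr hin,
    Real.norm_of_nonneg (by positivity), inv_mul_cancel_left₀ hm'.ne']

/-- The normals `e j`, `j ∈ J`, add up to a vector of length `N = m + 1 - |J|`, and the sum of the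
halfspace inequalities puts `x` at distance at least `1` from `g` in the opposite direction. The
only such point of the unit ball is the centroid of the face whose vertices are not in `J`. -/
lemma closedBall_inter_eq_singleton (hin : ∀ i j, inner ℝ (e i) (e j) =
    if i = j then m ^ 2 * r ^ 2 else -m * r ^ 2) {J : Finset (Fin (m + 1))}
    (hJ : J.card < m + 1) (hr : J.card * (m * r ^ 2) = m + 1 - J.card) :
    Metric.closedBall g 1 ∩ ⋂ j ∈ J, {x | inner ℝ (e j) (x - g) ≤ -m * r ^ 2} =
      {g - ((m : ℝ) + 1 - J.card)⁻¹ • ∑ i ∈ J, e i} := by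
  set N : ℝ := (m : ℝ) + 1 - J.card with hN
  have hN0 : 0 < N := by
    have : (J.card : ℝ) < m + 1 := by exact_mod_cast hJ
    linarith
  have hin' := inner_sum_of_gram hin J
  have hW : ‖∑ i ∈ J, e i‖ ^ 2 = N ^ 2 := by
    rw [← real_inner_self_eq_norm_sq, sum_inner, Finset.sum_congr rfl hin', Finset.sum_const,
      nsmul_eq_mul]
    linear_combination N * hr
  ext x
  simp only [Set.mem_inter_iff, Set.mem_iInter, Set.mem_ofPred_eq, Set.mem_singleton_iff,
    Metric.mem_closedBall]
  constructor
  · rintro ⟨hx1, hx2⟩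
    have h1 : inner ℝ (x - g) (∑ i ∈ J, e i) ≤ -N := by
      rw [real_inner_comm, sum_inner]
      refine (Finset.sum_le_sum hx2).trans (le_of_eq ?_)
      rw [Finset.sum_const, nsmul_eq_mul]
      linear_combination -hr
    have h2 : ‖x - g‖ ^ 2 ≤ 1 := pow_le_one₀ (norm_nonneg _) (by rwa [← dist_eq_norm])
    have h3 : ‖(x - g) + N⁻¹ • ∑ i ∈ J, e i‖ ^ 2 ≤ 0 := by
      rw [norm_add_sq_real, inner_smul_right, norm_smul, mul_pow, hW, Real.norm_eq_abs, sq_abs,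
        ← mul_pow, inv_mul_cancel₀ hN0.ne']
      have := mul_le_mul_of_nonneg_left h1 (inv_nonneg.2 hN0.le)
      rw [mul_neg, inv_mul_cancel₀ hN0.ne'] at this
      linarith
    have h4 := norm_eq_zero.1 (pow_eq_zero_iff two_ne_zero |>.1 (le_antisymm h3 (sq_nonneg _)))
    rw [eq_sub_iff_add_eq, ← sub_eq_zero, ← h4]
    abel
  · rintro rfl
    constructor
    · rw [dist_eq_norm, sub_sub_cancel_left, norm_neg, norm_smul,
        (pow_left_inj₀ (norm_nonneg _) hN0.le two_ne_zero).1 hW,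
        Real.norm_of_nonneg (by positivity),
        inv_mul_cancel₀ hN0.ne']
    · intro j hj
      rw [sub_sub_cancel_left, inner_neg_right, inner_smul_right, hin' j hj, ← hN]
      apply le_of_eq
      field_simp

end Extremal

lemma hellyRadius_sq {m k : ℕ} (hm : 0 < m) (hk : 1 ≤ k) (hkm : k < m + 1) :
    0 < hellyRadius (m + 1) k ∧ k * (m * hellyRadius (m + 1) k ^ 2) = (m : ℝ) + 1 - k := by
  have hm' : (0 : ℝ) < m := by exact_mod_cast hm
  have hk' : (0 : ℝ) < k := by exact_mod_cast hk
  have hkm' : (k : ℝ) < m + 1 := by exact_mod_cast hkm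
  have hpos : 0 < (((m + 1 : ℕ) : ℝ) - k) / (k * (((m + 1 : ℕ) : ℝ) - 1)) := by
    push_cast
    rw [add_sub_cancel_right]
    exact div_pos (by linarith) (by positivity)
  refine ⟨Real.sqrt_pos.2 hpos, ?_⟩
  rw [hellyRadius, Real.sq_sqrt hpos.le]
  push_cast
  rw [add_sub_cancel_right]
  field_simp

lemma IsClosedHalfspace.convex {d : ℕ} {H : Set (EuclideanSpace ℝ (Fin d))}
    (hH : IsClosedHalfspace H) : Convex ℝ H := by
  obtain ⟨a, c, -, rfl⟩ := hH
  exact convex_halfSpace_le (f := fun x => inner ℝ a x)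
    ⟨fun x y => inner_add_right a x y, fun s x => by simp [inner_smul_right]⟩ c

theorem theorem10 :
    -- the bound
    (∀ (d n k : ℕ), 1 ≤ k → k ≤ n →
      ∀ (K : Fin n → Set (EuclideanSpace ℝ (Fin d))), (∀ i, Convex ℝ (K i)) →
      ∀ b : EuclideanSpace ℝ (Fin d), BallMeetsIntersections k b K →
        ∃ q : EuclideanSpace ℝ (Fin d), ∀ i, Metric.infDist q (K i) ≤ hellyRadius n k) ∧
    -- it is attained by the regular simplex on `n = m + 1` vertices, for `1 ≤ k < n`
    (∀ (m k : ℕ) [NeZero m], 1 ≤ k → k < m + 1 →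
      -- a regular simplex with the prescribed inradius and facet halfspaces exist
      (∃ (S : Affine.Simplex ℝ (EuclideanSpace ℝ (Fin m)) m)
          (K : Fin (m + 1) → Set (EuclideanSpace ℝ (Fin m))),
        S.Regular ∧ S.inradius = hellyRadius (m + 1) k ∧
        ∀ i, IsClosedHalfspace (K i) ∧
          K i ∩ S.closedInterior = (S.faceOpposite i).closedInterior) ∧
      -- and every such simplex is extremal
      ∀ (S : Affine.Simplex ℝ (EuclideanSpace ℝ (Fin m)) m)
          (K : Fin (m + 1) → Set (EuclideanSpace ℝ (Fin m))),
        S.Regular → S.inradius = hellyRadius (m + 1) k →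
        (∀ i, IsClosedHalfspace (K i) ∧
          K i ∩ S.closedInterior = (S.faceOpposite i).closedInterior) →
        (∀ i, Convex ℝ (K i)) ∧
        (∀ J : Finset (Fin (m + 1)), J.card = k →
          ∃ z, Metric.closedBall S.incenter 1 ∩ ⋂ j ∈ J, K j = {z}) ∧
        (∀ i, Metric.infDist S.incenter (K i) = hellyRadius (m + 1) k) ∧
        (∀ q : EuclideanSpace ℝ (Fin m), ∃ i,
          hellyRadius (m + 1) k ≤ Metric.infDist q (K i))) := by
  refine ⟨fun d n k hk hkn K hK b hb => exists_infDist_le_hellyRadius hk hkn hK hb,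
    fun m k _ hk hkm => ?_⟩
  have hm := Nat.pos_of_neZero m
  have hm' : (0 : ℝ) < m := by exact_mod_cast hm
  obtain ⟨hr, hr2⟩ := hellyRadius_sq hm hk hkm
  set r := hellyRadius (m + 1) k
  refine ⟨?_, fun S K hS hSr hK => ?_⟩
  · obtain ⟨S, hS, hdist⟩ := exists_regular_simplex (m := m) (t := √(m * (m + 1)) * r)
      (by positivity)
    obtain ⟨-, hL, hin⟩ := gram_of_equilateral hdist
    have hSr : S.inradius = r := by
      rw [mul_pow, Real.sq_sqrt (by positivity)] at hL
      refine (pow_left_inj₀ S.inradius_pos.le hr.le two_ne_zero).1 ?_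
      refine mul_left_cancel₀ (by positivity : (2 * m * (m + 1) : ℝ) ≠ 0) ?_
      linarith
    refine ⟨S, fun i => {x | inner ℝ (S.points i - S.incenter) (x - S.incenter) ≤
      -m * S.inradius ^ 2}, hS, hSr, fun i => ⟨⟨S.points i - S.incenter,
        inner ℝ (S.points i - S.incenter) S.incenter - m * S.inradius ^ 2,
        sub_ne_zero.2 (S.incenter_ne_point i).symm, ?_⟩,
      facetHalfspace_inter_closedInterior hdist i⟩⟩
    ext x
    rw [Set.mem_ofPred_eq, Set.mem_ofPred_eq, inner_sub_right, sub_le_iff_le_add', neg_mul,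
      ← sub_eq_add_neg]
  · obtain ⟨ℓ, hℓ⟩ := hS.equilateral
    have hdist : ∀ i j, i ≠ j → dist (S.points i) (S.points j) ^ 2 = ℓ ^ 2 := fun i j hij => by
      rw [hℓ i j hij]
    obtain ⟨hsum, -, hin⟩ := gram_of_equilateral hdist
    have hKeq := fun i => eq_facetHalfspace hdist (hK i).1 (hK i).2
    rw [hSr] at hin
    simp_rw [hSr] at hKeq
    refine ⟨fun i => (hK i).1.convex, fun J hJ => ⟨S.incenter -
      ((m : ℝ) + 1 - J.card)⁻¹ • ∑ i ∈ J, (S.points i - S.incenter), ?_⟩, fun i => ?_, fun q => ?_⟩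
    · simp_rw [hKeq]
      exact closedBall_inter_eq_singleton hin (by rw [hJ]; exact hkm) (by rw [hJ]; exact hr2)
    · rw [hKeq]
      exact infDist_center hm hr.le hin i
    · obtain ⟨i, hi⟩ := exists_inner_nonneg_of_sum_eq_zero hsum (q - S.incenter)
      refine ⟨i, ?_⟩
      rw [hKeq]
      exact le_infDist_of_inner_nonneg hm hr.le hin hi
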